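/- Let $T\ge 4$ be a fixed integer and consider the panel change point model $$Y_{i,t}=\mu_i+\delta_i\,\mathcal I\{t>\tau\}+\sigma\varepsilon_{i,t},\qquad i=1,2,\ldots,\ t=1,\ldots,T,$$ with $\mu_i,\delta_i\in\mathbb R$, $\sigma>0$. Assume that the error vectors $[\varepsilon_{i,1},\ldots,\varepsilon_{i,T}]^\top$, $i=1,2,\ldots$, on a probability space $(\Omega,\mathcal F,\mathsf P)$ are i.i.d. with square integrable entries, $\mathsf E\,\varepsilon_{i,t}=0$, $\mathsf{Var}\,\varepsilon_{i,t}=1$, and $\mathsf{Cov}(\varepsilon_{i,s},\varepsilon_{i,s+h})=\rho_h$ for all $0\le h<T$ and $1\le s\le T-h$ (not depending on $s$). With $\rho_{-s}=\rho_s$ put $$r(t)=\sum_{|s|<t}(t-|s|)\rho_s,\qquad R(t,v)=\sum_{s=1}^{t}\sum_{u=t+1}^{v}\rho_{u-s}\quad(t<v).$$ Let $\bar Y_{i,t}=\frac1t\sum_{s=1}^tY_{i,s}$, $\widetilde Y_{i,t}=\frac1{T-t}\sum_{s=t+1}^TY_{i,s}$ and $$\mathcal R_N(T)=\max_{t=2,\ldots,T-2}\frac{\max_{s=1,\ldots,t}\left|\sum_{i=1}^N\sum_{r=1}^s\left(Y_{i,r}-\bar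 Y_{i,t}\right)\right|}{\max_{s=t,\ldots,T-1}\left|\sum_{i=1}^N\sum_{r=s+1}^T\left(Y_{i,r}-\widetilde Y_{i,t}\right)\right|},$$ where a ratio with denominator zero is given the value $0$. Suppose that the null hypothesis $\tau=T$ (no change) holds. Let $\Lambda=(\lambda_{t,v})_{t,v=1}^T$ be the symmetric matrix with $\lambda_{t,t}=r(t)$ and $\lambda_{t,v}=r(t)+R(t,v)$ for $t<v$. Then $\Lambda$ is positive semidefinite and, for $[X_1,\ldots,X_T]^\top$ multivariate normal with mean zero and covariance matrix $\Lambda$ and $Z_t=X_T-X_t$, as $N\to\infty$, $$\mathcal R_N(T)\ \xrightarrow{\ \mathscr D\ }\ \max_{t=2,\ldots,T-2}\frac{\max_{s=1,\ldots,t}\left|X_s-\frac stX_t\right|}{\max_{s=t,\ldots,T-1}\left|Z_s-\frac{T-s}{T-t}Z_t\right|}$$ (with the same convention for zero denominators). If $\rho_1\ne1$, the convention is immaterial: the denominators in the limit are almost surely all nonzero, and the probability that some denominator in $\mathcal R_N(T)$ vanishes tends to $0$. -/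

import Mathlib

open MeasureTheory ProbabilityTheory Filter Topology

noncomputable section

/-- Maximum of `f` over a finite index set (every use below is over a nonempty set; the value
over the empty set is set to `0`). -/
def maxOver (S : Finset ℕ) (f : ℕ → ℝ) : ℝ :=
  if h : S.Nonempty then S.sup' h f else 0

/-- Assumption on the errors `ε i t`, panel `i` (panels are numbered `0, 1, 2, …`),
time `t = 1, …, T`: the error vectors of the panels are i.i.d. with square integrable entries,
mean zero and variance one, and the covariance at lag `h` is `ρ h`, whatever the time `s`. -/
structure PanelErrors {Ω : Type*} [MeasurableSpace Ω] (P : Measure Ω) (T : ℕ)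
    (ε : ℕ → ℕ → Ω → ℝ) (ρ : ℕ → ℝ) : Prop where
  indep : iIndepFun (fun (i : ℕ) (ω : Ω) (t : Finset.Icc 1 T) => ε i t ω) P
  identDistrib : ∀ i j : ℕ, IdentDistrib (fun (ω : Ω) (t : Finset.Icc 1 T) => ε i t ω)
    (fun (ω : Ω) (t : Finset.Icc 1 T) => ε j t ω) P P
  memLp : ∀ i : ℕ, ∀ t ∈ Finset.Icc 1 T, MemLp (ε i t) 2 P
  mean : ∀ i : ℕ, ∀ t ∈ Finset.Icc 1 T, ∫ ω, ε i t ω ∂P = 0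
  var : ∀ i : ℕ, ∀ t ∈ Finset.Icc 1 T, variance (ε i t) P = 1
  autocov : ∀ i : ℕ, ∀ h < T, ∀ s ∈ Finset.Icc 1 (T - h),
    covariance (ε i s) (ε i (s + h)) P = ρ h

/-- The panel change point model `Y i t = μ i + δ i * 1{t > τ} + σ * ε i t`. -/
def panelObs {Ω : Type*} (μ δ : ℕ → ℝ) (τ : ℕ) (σ : ℝ) (ε : ℕ → ℕ → Ω → ℝ) :
    ℕ → ℕ → Ω → ℝ :=
  fun i t ω => μ i + δ i * (if τ < t then 1 else 0) + σ * ε i t ω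

/-- Average of the first `t` observations of a series. -/
def firstAvg (y : ℕ → ℝ) (t : ℕ) : ℝ :=
  (1 / (t : ℝ)) * ∑ s ∈ Finset.Icc 1 t, y s

/-- Average of the last `T - t` observations of a series observed at times `1, …, T`. -/
def lastAvg (T : ℕ) (y : ℕ → ℝ) (t : ℕ) : ℝ :=
  (1 / ((T : ℝ) - t)) * ∑ s ∈ Finset.Icc (t + 1) T, y s

/-- Numerator of the `t`-th ratio of the statistic for the panels `y 0, …, y (N - 1)`. -/
def statNum (N : ℕ) (y : ℕ → ℕ → ℝ) (t : ℕ) : ℝ :=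
  maxOver (Finset.Icc 1 t) fun s =>
    |∑ i ∈ Finset.range N, ∑ r ∈ Finset.Icc 1 s, (y i r - firstAvg (y i) t)|

/-- Denominator of the `t`-th ratio of the statistic. -/
def statDen (T N : ℕ) (y : ℕ → ℕ → ℝ) (t : ℕ) : ℝ :=
  maxOver (Finset.Icc t (T - 1)) fun s =>
    |∑ i ∈ Finset.range N, ∑ r ∈ Finset.Icc (s + 1) T, (y i r - lastAvg T (y i) t)|

/-- The ratio type statistic computed from the data `y i t`, `i < N`, `1 ≤ t ≤ T`. -/
def ratioStat (T N : ℕ) (y : ℕ → ℕ → ℝ) : ℝ :=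
  maxOver (Finset.Icc 2 (T - 2)) fun t => statNum N y t / statDen T N y t

/-- Cumulative autocorrelation function `r(t) = ∑_{|s| < t} (t - |s|) ρ_s`, with `ρ_{-s} = ρ_s`. -/
def cumAutocorr (ρ : ℕ → ℝ) (t : ℕ) : ℝ :=
  ∑ s ∈ Finset.Ioo (-(t : ℤ)) (t : ℤ), ((t : ℝ) - |(s : ℝ)|) * ρ s.natAbs

/-- Shifted cumulative correlation function `R(t, v) = ∑_{s=1}^t ∑_{u=t+1}^v ρ_{u-s}`, `t < v`. -/
def shiftedCumCorr (ρ : ℕ → ℝ) (t v : ℕ) : ℝ :=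
  ∑ s ∈ Finset.Icc 1 t, ∑ u ∈ Finset.Icc (t + 1) v, ρ (u - s)

/-- The matrix `Λ`, indexed by the times `1, …, T`: `λ_{t,t} = r(t)`,
`λ_{t,v} = r(t) + R(t, v)` for `t < v`, extended symmetrically. -/
def limitCov (T : ℕ) (ρ : ℕ → ℝ) : Matrix (Finset.Icc 1 T) (Finset.Icc 1 T) ℝ :=
  Matrix.of fun t v =>
    if (t : ℕ) = v then cumAutocorr ρ t
    else cumAutocorr ρ (min (t : ℕ) v) + shiftedCumCorr ρ (min (t : ℕ) v) (max (t : ℕ) v)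

/-- Numerator of the `t`-th ratio of the limit. -/
def limitNum (x : ℕ → ℝ) (t : ℕ) : ℝ :=
  maxOver (Finset.Icc 1 t) fun s => |x s - (s : ℝ) / t * x t|

/-- Denominator of the `t`-th ratio of the limit, with `z t = x T - x t`. -/
def limitDen (T : ℕ) (x : ℕ → ℝ) (t : ℕ) : ℝ :=
  let z : ℕ → ℝ := fun u => x T - x u
  maxOver (Finset.Icc t (T - 1)) fun s => |z s - ((T : ℝ) - s) / ((T : ℝ) - t) * z t|

/-- The functional of `x 1, …, x T` which defines the limit. -/
def limitRatio (T : ℕ) (x : ℕ → ℝ) : ℝ :=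
  maxOver (Finset.Icc 2 (T - 2)) fun t => limitNum x t / limitDen T x t

end

/-!
Let `S i t = ε i 1 + ⋯ + ε i t` and let `W N` be the vector of the `N^{-1/2} ∑_{i < N} S i t`,
`t = 1, …, T`. Under the null hypothesis the sums over time in the statistic are linear
combinations of `σ S i t`: the panel means cancel, and the factor `σ √N` common to numerators and
denominators cancels in the ratios, so the statistic equals `limitRatio T` evaluated at `W N`
(`ratioStat_eq`, `limitRatio_timeExt_scaledSums`).

The matrix `Λ` is the covariance matrix of `(S i 1, …, S i T)`
(`PanelErrors.covariance_partialSum_eq_limitCov`), hence positive semidefinite, and `W N` converges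
in distribution to `N(0, Λ)` by the multivariate central limit theorem
(`tendstoInDistribution_inv_sqrt_smul_sum`).

If `ρ 1 ≠ 1`, a vanishing `t`-th denominator forces `x` to be affine on `{t, …, T}`, in particular
`2 x (t + 1) = x t + x (t + 2)`. For the limit vector the difference of the two sides is normal with
variance `Var (ε (t + 1) - ε (t + 2)) = 2 - 2 ρ 1 > 0`, so almost surely no denominator vanishes
(`PanelErrors.ae_limitDen_ne_zero`). The functional is thus continuous at almost every value of the
limit, and the mapping theorem (`tendstoInDistribution_comp_of_ae_continuousAt`) gives the
convergence. The points with a zero denominator form a closed null set for the limit law, so the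
portmanteau theorem shows that the statistic has one with probability tending to zero.

If `ρ 1 = 1`, all errors of a panel coincide almost surely, the partial sums are linear in `t`, every
numerator is zero, and both the statistic and its limit are almost surely `0`.
-/

/-! ### Weak convergence -/

/-- Mapping theorem for a measurable map that is continuous at almost every point of the limit. -/
theorem tendstoInDistribution_comp_of_ae_continuousAt {Ω Ω' E F : Type*} [MeasurableSpace Ω]
    {P : Measure Ω} [IsProbabilityMeasure P] [MeasurableSpace Ω'] {P' : Measure Ω'}
    [IsProbabilityMeasure P'] [TopologicalSpace E] [MeasurableSpace E] [OpensMeasurableSpace E]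
    [HasOuterApproxClosed E] [TopologicalSpace F] [MeasurableSpace F] [OpensMeasurableSpace F]
    {W : ℕ → Ω → E} {X : Ω' → E} {g : E → F} (hg : Measurable g)
    (hgc : ∀ᵐ ω ∂P', ContinuousAt g (X ω))
    (h : TendstoInDistribution W atTop X (fun _ => P) P') :
    TendstoInDistribution (fun n ω => g (W n ω)) atTop (fun ω => g (X ω)) (fun _ => P) P' where
  forall_aemeasurable n := hg.comp_aemeasurable (h.forall_aemeasurable n)
  aemeasurable_limit := hg.comp_aemeasurable h.aemeasurable_limit
  tendsto := by
    refine tendsto_of_forall_isOpen_le_liminf' fun G hG => ?_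
    have hWn := h.forall_aemeasurable
    have hX := h.aemeasurable_limit
    have key := ProbabilityMeasure.le_liminf_measure_open_of_tendsto h.tendsto
      (isOpen_interior (s := g ⁻¹' G))
    simp only [ProbabilityMeasure.coe_mk] at key ⊢
    have hgW (n : ℕ) : AEMeasurable (fun ω => g (W n ω)) P := hg.comp_aemeasurable (hWn n)
    have hgX : AEMeasurable (fun ω => g (X ω)) P' := hg.comp_aemeasurable hX
    rw [Measure.map_apply_of_aemeasurable hgX hG.measurableSet]
    rw [Measure.map_apply_of_aemeasurable hX isOpen_interior.measurableSet] at key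
    have h1 : P' ((fun ω => g (X ω)) ⁻¹' G) ≤ P' (X ⁻¹' interior (g ⁻¹' G)) := by
      refine measure_mono_ae ?_
      filter_upwards [hgc] with ω hω hmem
      exact mem_interior_iff_mem_nhds.2 (hω (hG.mem_nhds hmem))
    refine h1.trans (key.trans (liminf_le_liminf (Eventually.of_forall fun n => ?_)))
    rw [Measure.map_apply_of_aemeasurable (hgW n) hG.measurableSet,
      Measure.map_apply_of_aemeasurable (hWn n) isOpen_interior.measurableSet]
    exact measure_mono fun ω hω => interior_subset (s := g ⁻¹' G) hω

/-! ### Covariance matrices and the multivariate central limit theorem -/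

section Multivariate

variable {ι : Type*} [Fintype ι] {Ω : Type*} [MeasurableSpace Ω] {P : Measure Ω}
  [IsProbabilityMeasure P]

theorem variance_inner_toLp {Z : ι → Ω → ℝ} {S : Matrix ι ι ℝ} (hZ : ∀ a, MemLp (Z a) 2 P)
    (hS : ∀ a b, covariance (Z a) (Z b) P = S a b) (u : EuclideanSpace ℝ ι) :
    variance (fun ω => inner ℝ u (WithLp.toLp 2 fun a => Z a ω)) P = u ⬝ᵥ S.mulVec u := by
  have h1 : (fun ω => inner ℝ u (WithLp.toLp 2 fun a => Z a ω)) =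
      fun ω => ∑ a, u a * Z a ω := by
    ext ω
    simp [PiLp.inner_apply, mul_comm]
  have h2 (a : ι) : MemLp (fun ω => u a * Z a ω) 2 P := (hZ a).const_mul _
  rw [h1, ← covariance_self (memLp_finsetSum _ fun a _ => h2 a).aemeasurable,
    covariance_fun_sum_fun_sum h2 h2]
  simp only [covariance_const_mul_left, covariance_const_mul_right, hS, dotProduct, Matrix.mulVec,
    Finset.mul_sum]
  exact Finset.sum_congr rfl fun a _ => Finset.sum_congr rfl fun b _ => by ring

theorem posSemidef_of_covariance {Z : ι → Ω → ℝ} {S : Matrix ι ι ℝ} (hZ : ∀ a, MemLp (Z a) 2 P)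
    (hS : ∀ a b, covariance (Z a) (Z b) P = S a b) : S.PosSemidef := by
  refine Matrix.PosSemidef.of_dotProduct_mulVec_nonneg ?_ fun x => ?_
  · ext a b
    simp [← hS, covariance_comm]
  · have := variance_inner_toLp hZ hS (WithLp.toLp 2 x)
    simp only [star_trivial]
    rw [← this]
    exact variance_nonneg _ _

theorem charFun_map_eq_charFun_map_inner {Ω : Type*} [MeasurableSpace Ω] {Q : Measure Ω}
    {Z : Ω → EuclideanSpace ℝ ι} (hZ : AEMeasurable Z Q) (u : EuclideanSpace ℝ ι) :
    charFun (Q.map Z) u = charFun (Q.map fun ω => inner ℝ u (Z ω)) 1 := by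
  rw [charFun_apply, charFun_apply, integral_map hZ (by fun_prop),
    integral_map (by fun_prop) (by fun_prop)]
  simp [real_inner_comm]

variable [DecidableEq ι]

theorem hasLaw_inner_of_multivariateGaussian {Ω' : Type*} [MeasurableSpace Ω'] {P' : Measure Ω'}
    {S : Matrix ι ι ℝ} (hS : S.PosSemidef) {X : Ω' → EuclideanSpace ℝ ι}
    (hX : HasLaw X (multivariateGaussian 0 S) P') (u : EuclideanSpace ℝ ι) :
    HasLaw (fun ω => inner ℝ u (X ω)) (gaussianReal 0 (u ⬝ᵥ S.mulVec u).toNNReal) P' := by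
  have hm : Measurable fun x : EuclideanSpace ℝ ι => inner ℝ u x := by fun_prop
  refine HasLaw.fun_comp ⟨hm.aemeasurable, ?_⟩ hX
  have h1 := IsGaussian.map_eq_gaussianReal (μ := multivariateGaussian 0 S) (innerSL ℝ u)
  have h2 : (multivariateGaussian 0 S)[innerSL ℝ u] = 0 := by
    rw [ContinuousLinearMap.integral_comp_id_comm IsGaussian.integrable_id]
    simp
  have h3 : Var[innerSL ℝ u; multivariateGaussian 0 S] = u ⬝ᵥ S.mulVec u := by
    rw [← covarianceBilin_multivariateGaussian (μ := 0) hS, covarianceBilin_self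
      IsGaussian.memLp_two_id]
    rfl
  rw [h2, h3] at h1
  exact h1

/-- The central limit theorem for i.i.d. centred random vectors with square integrable entries.
By the Lévy convergence theorem (the Cramér–Wold device) it reduces to the real central limit
theorem for the inner products with a fixed vector. -/
theorem tendstoInDistribution_inv_sqrt_smul_sum {Ω' : Type*} [MeasurableSpace Ω']
    {P' : Measure Ω'} [IsProbabilityMeasure P'] {V : ℕ → Ω → ι → ℝ} {S : Matrix ι ι ℝ}
    (hindep : iIndepFun V P) (hident : ∀ i, IdentDistrib (V i) (V 0) P P)
    (hmem : ∀ a, MemLp (fun ω => V 0 ω a) 2 P) (hmean : ∀ a, ∫ ω, V 0 ω a ∂P = 0)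
    (hcov : ∀ a b, covariance (fun ω => V 0 ω a) (fun ω => V 0 ω b) P = S a b)
    {X : Ω' → EuclideanSpace ℝ ι} (hX : HasLaw X (multivariateGaussian 0 S) P') :
    TendstoInDistribution
      (fun (n : ℕ) ω => (√n)⁻¹ • ∑ i ∈ Finset.range n, WithLp.toLp 2 (V i ω)) atTop X
      (fun _ => P) P' := by
  have hS := posSemidef_of_covariance hmem hcov
  have hV (i : ℕ) : AEMeasurable (fun ω => WithLp.toLp 2 (V i ω)) P :=
    (PiLp.continuous_toLp 2 (fun _ : ι => ℝ)).measurable.comp_aemeasurable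
      (hident i).aemeasurable_fst
  have hW (n : ℕ) : AEMeasurable
      (fun ω => (√n)⁻¹ • ∑ i ∈ Finset.range n, WithLp.toLp 2 (V i ω)) P :=
    by
    have := Finset.aemeasurable_fun_sum (Finset.range n) fun i _ => hV i
    fun_prop
  refine ⟨hW, hX.aemeasurable, ProbabilityMeasure.tendsto_iff_tendsto_charFun.2 fun u => ?_⟩
  have hu : Measurable fun v : ι → ℝ => inner ℝ u (WithLp.toLp 2 v) := by fun_prop
  have hvar : variance (fun ω => inner ℝ u (WithLp.toLp 2 (V 0 ω))) P = u ⬝ᵥ S.mulVec u :=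
    variance_inner_toLp hmem hcov u
  have hmem' : MemLp (fun ω => inner ℝ u (WithLp.toLp 2 (V 0 ω))) 2 P := by
    simp only [PiLp.inner_apply]
    exact memLp_finsetSum _ fun a _ => by simpa [mul_comm] using (hmem a).const_mul (u a)
  have hmean' : ∫ ω, inner ℝ u (WithLp.toLp 2 (V 0 ω)) ∂P = 0 := by
    simp only [PiLp.inner_apply, RCLike.inner_apply, conj_trivial]
    rw [integral_finsetSum _ fun a _ =>
      ((hmem a).integrable (by norm_num)).mul_const (u a)]
    simp [integral_mul_const, hmean]
  have hclt := tendstoInDistribution_inv_sqrt_mul_sum_sub (P := P)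
    (X := fun i ω => inner ℝ u (WithLp.toLp 2 (V i ω)))
    (hvar ▸ hasLaw_inner_of_multivariateGaussian hS hX u) hmem'
    (hindep.comp (fun _ v => inner ℝ u (WithLp.toLp 2 v)) fun _ => hu)
    (fun i => (hident i).comp hu)
  have h1 := ProbabilityMeasure.tendsto_iff_tendsto_charFun.1 hclt.tendsto 1
  rw [ProbabilityMeasure.coe_mk, charFun_map_eq_charFun_map_inner hX.aemeasurable]
  simp only [ProbabilityMeasure.coe_mk, charFun_map_eq_charFun_map_inner (hW _)]
  rw [(hasLaw_inner_of_multivariateGaussian hS hX u).map_eq]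
  simpa [hmean', inner_smul_right, inner_sum,
    (hasLaw_inner_of_multivariateGaussian hS hX u).map_eq] using h1

end Multivariate

/-! ### The maximum over a finite index set -/

theorem maxOver_congr {S : Finset ℕ} {f g : ℕ → ℝ} (h : ∀ s ∈ S, f s = g s) :
    maxOver S f = maxOver S g := by
  unfold maxOver
  split_ifs with hS
  · exact Finset.sup'_congr hS rfl h
  · rfl

theorem le_maxOver {S : Finset ℕ} (f : ℕ → ℝ) {s : ℕ} (hs : s ∈ S) : f s ≤ maxOver S f := by
  rw [maxOver, dif_pos ⟨s, hs⟩]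
  exact Finset.le_sup' f hs

theorem maxOver_const_mul (S : Finset ℕ) (f : ℕ → ℝ) {c : ℝ} (hc : 0 ≤ c) :
    maxOver S (fun s => c * f s) = c * maxOver S f := by
  unfold maxOver
  split_ifs with hS
  · exact (Finset.apply_sup'_eq_sup'_comp hS (c * ·) fun a b => mul_max_of_nonneg a b hc).symm
  · simp

theorem maxOver_eq_zero {S : Finset ℕ} {f : ℕ → ℝ} (h : ∀ s ∈ S, f s = 0) : maxOver S f = 0 := by
  have h1 : maxOver S f = maxOver S fun s => 0 * f s := maxOver_congr fun s hs => by simp [h s hs]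
  rw [h1, maxOver_const_mul S f le_rfl, zero_mul]

theorem continuousAt_maxOver {E : Type*} [TopologicalSpace E] {S : Finset ℕ} {f : ℕ → E → ℝ}
    {w : E} (h : ∀ s ∈ S, ContinuousAt (f s) w) :
    ContinuousAt (fun w => maxOver S fun s => f s w) w := by
  unfold maxOver
  split_ifs with hS
  · exact ContinuousAt.finset_sup'_apply hS h
  · exact continuousAt_const

theorem measurable_maxOver {E : Type*} [MeasurableSpace E] {S : Finset ℕ} {f : ℕ → E → ℝ}
    (h : ∀ s ∈ S, Measurable (f s)) : Measurable fun w => maxOver S fun s => f s w := by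
  unfold maxOver
  split_ifs with hS
  · convert! Finset.measurable_sup' hS h using 1
    ext w
    simp
  · exact measurable_const

/-! ### The statistic as a functional of partial sums -/

/-- The partial sums `e 1 + ⋯ + e s`. -/
noncomputable def partialSum (e : ℕ → ℝ) (s : ℕ) : ℝ := ∑ r ∈ Finset.Icc 1 s, e r

theorem partialSum_add_one (e : ℕ → ℝ) (s : ℕ) :
    partialSum e (s + 1) = partialSum e s + e (s + 1) :=
  Finset.sum_Icc_succ_top (by omega) _

theorem sum_Icc_eq_partialSum_sub (e : ℕ → ℝ) {s T : ℕ} (h : s ≤ T) :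
    ∑ r ∈ Finset.Icc (s + 1) T, e r = partialSum e T - partialSum e s := by
  induction T, h using Nat.le_induction with
  | base => simp
  | succ T hT ih => rw [Finset.sum_Icc_succ_top (by omega), ih, partialSum_add_one]; ring

theorem limitNum_congr {T : ℕ} {x x' : ℕ → ℝ} (h : ∀ t ∈ Finset.Icc 1 T, x t = x' t) {t : ℕ}
    (ht : t ∈ Finset.Icc 2 (T - 2)) : limitNum x t = limitNum x' t := by
  refine maxOver_congr fun s hs => ?_
  simp only [Finset.mem_Icc] at ht hs
  rw [h s (Finset.mem_Icc.2 (by omega)), h t (Finset.mem_Icc.2 (by omega))]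

theorem limitDen_congr {T : ℕ} {x x' : ℕ → ℝ} (h : ∀ t ∈ Finset.Icc 1 T, x t = x' t) {t : ℕ}
    (ht : t ∈ Finset.Icc 2 (T - 2)) : limitDen T x t = limitDen T x' t := by
  refine maxOver_congr fun s hs => ?_
  simp only [Finset.mem_Icc] at ht hs
  dsimp only
  rw [h s (Finset.mem_Icc.2 (by omega)), h t (Finset.mem_Icc.2 (by omega)),
    h T (Finset.mem_Icc.2 (by omega))]

theorem limitRatio_congr {T : ℕ} {x x' : ℕ → ℝ} (h : ∀ t ∈ Finset.Icc 1 T, x t = x' t) :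
    limitRatio T x = limitRatio T x' :=
  maxOver_congr fun t ht => by rw [limitNum_congr h ht, limitDen_congr h ht]

theorem limitNum_const_mul {c : ℝ} (hc : 0 ≤ c) (x : ℕ → ℝ) (t : ℕ) :
    limitNum (fun s => c * x s) t = c * limitNum x t := by
  unfold limitNum
  rw [← maxOver_const_mul _ _ hc]
  refine maxOver_congr fun s _ => ?_
  rw [← abs_of_nonneg hc, ← abs_mul, abs_of_nonneg hc]
  ring_nf

theorem limitDen_const_mul {c : ℝ} (hc : 0 ≤ c) (T : ℕ) (x : ℕ → ℝ) (t : ℕ) :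
    limitDen T (fun s => c * x s) t = c * limitDen T x t := by
  unfold limitDen
  rw [← maxOver_const_mul _ _ hc]
  refine maxOver_congr fun s _ => ?_
  rw [← abs_of_nonneg hc, ← abs_mul, abs_of_nonneg hc]
  ring_nf

theorem limitRatio_const_mul {c : ℝ} (hc : 0 < c) (T : ℕ) (x : ℕ → ℝ) :
    limitRatio T (fun s => c * x s) = limitRatio T x :=
  maxOver_congr fun t _ => by
    rw [limitNum_const_mul hc.le, limitDen_const_mul hc.le, mul_div_mul_left _ _ hc.ne']

theorem statNum_eq {T N : ℕ} {y e : ℕ → ℕ → ℝ} {m : ℕ → ℝ} {σ : ℝ} (hσ : 0 ≤ σ)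
    (hy : ∀ i, ∀ r ∈ Finset.Icc 1 T, y i r = m i + σ * e i r) {t : ℕ}
    (ht : t ∈ Finset.Icc 2 (T - 2)) :
    statNum N y t = σ * limitNum (fun s => ∑ i ∈ Finset.range N, partialSum (e i) s) t := by
  unfold statNum limitNum
  rw [← maxOver_const_mul _ _ hσ]
  refine maxOver_congr fun s hs => ?_
  simp only [Finset.mem_Icc] at ht hs
  have hsum (i : ℕ) {v : ℕ} (hv : v ≤ T) :
      ∑ r ∈ Finset.Icc 1 v, y i r = v * m i + σ * partialSum (e i) v := by
    rw [Finset.sum_congr rfl fun r hr => hy i r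
      (Finset.mem_Icc.2 ⟨(Finset.mem_Icc.1 hr).1, (Finset.mem_Icc.1 hr).2.trans hv⟩),
      Finset.sum_add_distrib, ← Finset.mul_sum]
    simp [partialSum]
  have ht0 : (t : ℝ) ≠ 0 := by
    have : t ≠ 0 := by omega
    exact_mod_cast this
  have h1 (i : ℕ) : ∑ r ∈ Finset.Icc 1 s, (y i r - firstAvg (y i) t) =
      σ * (partialSum (e i) s - (s : ℝ) / t * partialSum (e i) t) := by
    rw [Finset.sum_sub_distrib, hsum i (by omega), firstAvg, hsum i (by omega)]
    simp only [Finset.sum_const, Nat.card_Icc, nsmul_eq_mul, add_tsub_cancel_right]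
    field_simp
    ring
  rw [Finset.sum_congr rfl fun i _ => h1 i, ← Finset.mul_sum, abs_mul, abs_of_nonneg hσ,
    Finset.sum_sub_distrib, Finset.mul_sum]

theorem statDen_eq {T N : ℕ} {y e : ℕ → ℕ → ℝ} {m : ℕ → ℝ} {σ : ℝ} (hσ : 0 ≤ σ)
    (hy : ∀ i, ∀ r ∈ Finset.Icc 1 T, y i r = m i + σ * e i r) {t : ℕ}
    (ht : t ∈ Finset.Icc 2 (T - 2)) :
    statDen T N y t = σ * limitDen T (fun s => ∑ i ∈ Finset.range N, partialSum (e i) s) t := by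
  unfold statDen limitDen
  rw [← maxOver_const_mul _ _ hσ]
  refine maxOver_congr fun s hs => ?_
  simp only [Finset.mem_Icc] at ht hs
  have hsum (i : ℕ) {v : ℕ} (hv : v ≤ T) : ∑ r ∈ Finset.Icc (v + 1) T, y i r =
      ((T : ℝ) - v) * m i + σ * (partialSum (e i) T - partialSum (e i) v) := by
    rw [Finset.sum_congr rfl fun r hr => hy i r
      (Finset.mem_Icc.2 ⟨by have := (Finset.mem_Icc.1 hr).1; omega, (Finset.mem_Icc.1 hr).2⟩),
      Finset.sum_add_distrib, ← Finset.mul_sum, sum_Icc_eq_partialSum_sub (e i) hv]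
    simp [Nat.cast_sub hv]
  have ht0 : (T : ℝ) - t ≠ 0 := by
    have : (t : ℝ) < T := by exact_mod_cast (by omega : t < T)
    linarith
  have h1 (i : ℕ) : ∑ r ∈ Finset.Icc (s + 1) T, (y i r - lastAvg T (y i) t) =
      σ * ((partialSum (e i) T - partialSum (e i) s) -
        ((T : ℝ) - s) / ((T : ℝ) - t) * (partialSum (e i) T - partialSum (e i) t)) := by
    rw [Finset.sum_sub_distrib, hsum i (by omega), lastAvg, hsum i (by omega)]
    simp only [Finset.sum_const, Nat.card_Icc, nsmul_eq_mul, Nat.reduceSubDiff,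
      Nat.cast_sub (by omega : s ≤ T)]
    field_simp
    ring
  rw [Finset.sum_congr rfl fun i _ => h1 i, ← Finset.mul_sum, abs_mul, abs_of_nonneg hσ,
    Finset.sum_sub_distrib, Finset.sum_sub_distrib, ← Finset.mul_sum, Finset.sum_sub_distrib]

theorem ratioStat_eq {T N : ℕ} {y e : ℕ → ℕ → ℝ} {m : ℕ → ℝ} {σ : ℝ} (hσ : 0 < σ)
    (hy : ∀ i, ∀ r ∈ Finset.Icc 1 T, y i r = m i + σ * e i r) :
    ratioStat T N y = limitRatio T fun s => ∑ i ∈ Finset.range N, partialSum (e i) s :=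
  maxOver_congr fun t ht => by
    rw [statNum_eq hσ.le hy ht, statDen_eq hσ.le hy ht, mul_div_mul_left _ _ hσ.ne']

/-- If the `t`-th denominator vanishes, then `x` is affine on `{t, …, T}`; only the second
difference at `t` is needed. -/
theorem two_mul_eq_of_limitDen_eq_zero {T t : ℕ} {x : ℕ → ℝ} (ht : t ∈ Finset.Icc 2 (T - 2))
    (h : limitDen T x t = 0) : 2 * x (t + 1) = x t + x (t + 2) := by
  simp only [Finset.mem_Icc] at ht
  have hn : (T : ℝ) - t ≠ 0 := by
    have : (t : ℝ) < T := by exact_mod_cast (by omega : t < T)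
    linarith
  have key (s : ℕ) (hts : t ≤ s) (hsT : s ≤ T) :
      (x T - x s) - ((T : ℝ) - s) / ((T : ℝ) - t) * (x T - x t) = 0 := by
    rcases hsT.eq_or_lt with rfl | hsT
    · simp
    · rw [← abs_nonpos_iff, ← h]
      exact le_maxOver (fun s => |(x T - x s) - ((T : ℝ) - s) / ((T : ℝ) - t) * (x T - x t)|)
        (Finset.mem_Icc.2 (by omega))
  have h1 := key (t + 1) (by omega) (by omega)
  have h2 := key (t + 2) (by omega) (by omega)
  field_simp at h1 h2
  push_cast at h1 h2
  have : ((T : ℝ) - t) * (2 * x (t + 1) - x t - x (t + 2)) = 0 := by linear_combination h2 - 2 * h1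
  have := (mul_eq_zero.1 this).resolve_left hn
  linarith

theorem limitRatio_eq_zero_of_linear {T : ℕ} {x : ℕ → ℝ} {a : ℝ}
    (h : ∀ s ∈ Finset.Icc 1 T, x s = s * a) : limitRatio T x = 0 := by
  refine maxOver_eq_zero fun t ht => ?_
  have : limitNum x t = 0 := maxOver_eq_zero fun s hs => by
    simp only [Finset.mem_Icc] at ht hs
    have ht0 : (t : ℝ) ≠ 0 := by
      have : t ≠ 0 := by omega
      exact_mod_cast this
    rw [h s (Finset.mem_Icc.2 (by omega)), h t (Finset.mem_Icc.2 (by omega)), abs_eq_zero]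
    field_simp
    ring
  rw [this, zero_div]

/-! ### Continuity and measurability -/

/-- A vector indexed by the times `1, …, T`, extended by zero to a sequence. -/
noncomputable def timeExt {T : ℕ} (e : Finset.Icc 1 T → ℝ) (t : ℕ) : ℝ :=
  if h : t ∈ Finset.Icc 1 T then e ⟨t, h⟩ else 0

theorem timeExt_of_mem {T : ℕ} (e : Finset.Icc 1 T → ℝ) {t : ℕ} (h : t ∈ Finset.Icc 1 T) :
    timeExt e t = e ⟨t, h⟩ := dif_pos h

theorem continuous_timeExt {T : ℕ} (t : ℕ) :
    Continuous fun w : EuclideanSpace ℝ (Finset.Icc 1 T) => timeExt w t := by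
  unfold timeExt
  split_ifs <;> fun_prop

theorem continuous_limitNum_timeExt {T : ℕ} (t : ℕ) :
    Continuous fun w : EuclideanSpace ℝ (Finset.Icc 1 T) => limitNum (timeExt w) t := by
  have := fun s => continuous_timeExt (T := T) s
  exact continuous_iff_continuousAt.2 fun w => continuousAt_maxOver fun s _ => by fun_prop

theorem continuous_limitDen_timeExt {T : ℕ} (t : ℕ) :
    Continuous fun w : EuclideanSpace ℝ (Finset.Icc 1 T) => limitDen T (timeExt w) t := by
  have := fun s => continuous_timeExt (T := T) s
  exact continuous_iff_continuousAt.2 fun w => continuousAt_maxOver fun s _ => by fun_prop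

theorem measurable_limitRatio_timeExt {T : ℕ} :
    Measurable fun w : EuclideanSpace ℝ (Finset.Icc 1 T) => limitRatio T (timeExt w) :=
  measurable_maxOver fun t _ => (continuous_limitNum_timeExt t).measurable.div
    (continuous_limitDen_timeExt t).measurable

theorem continuousAt_limitRatio_timeExt {T : ℕ} {w : EuclideanSpace ℝ (Finset.Icc 1 T)}
    (hw : ∀ t ∈ Finset.Icc 2 (T - 2), limitDen T (timeExt w) t ≠ 0) :
    ContinuousAt (fun w : EuclideanSpace ℝ (Finset.Icc 1 T) => limitRatio T (timeExt w)) w :=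
  continuousAt_maxOver fun t ht => (continuous_limitNum_timeExt t).continuousAt.div
    (continuous_limitDen_timeExt t).continuousAt (hw t ht)

/-! ### The covariance matrix of the partial sums -/

theorem sum_Ioo_neg_natAbs (ρ : ℕ → ℝ) (t : ℕ) :
    ∑ s ∈ Finset.Ioo (-((t : ℤ) + 1)) ((t : ℤ) + 1), ρ s.natAbs =
      ρ 0 + 2 * ∑ u ∈ Finset.Icc 1 t, ρ u := by
  induction t with
  | zero =>
    have : Finset.Ioo (-(((0 : ℕ) : ℤ) + 1)) (((0 : ℕ) : ℤ) + 1) = {0} := by decide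
    rw [this]
    simp
  | succ t ih =>
    have h : Finset.Ioo (-(((t + 1 : ℕ) : ℤ) + 1)) (((t + 1 : ℕ) : ℤ) + 1) =
        insert ((t : ℤ) + 1) (insert (-((t : ℤ) + 1))
          (Finset.Ioo (-((t : ℤ) + 1)) ((t : ℤ) + 1))) := by
      ext s
      simp only [Finset.mem_Ioo, Finset.mem_insert]
      omega
    have h1 : ((t : ℤ) + 1).natAbs = t + 1 := by omega
    have h2 : (-((t : ℤ) + 1)).natAbs = t + 1 := by omega
    rw [h, Finset.sum_insert (by simp; omega), Finset.sum_insert (by simp), ih, h1, h2,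
      Finset.sum_Icc_succ_top (by omega)]
    ring

theorem cumAutocorr_add_one (ρ : ℕ → ℝ) (t : ℕ) :
    cumAutocorr ρ (t + 1) = cumAutocorr ρ t + (ρ 0 + 2 * ∑ u ∈ Finset.Icc 1 t, ρ u) := by
  have h1 : cumAutocorr ρ t = ∑ s ∈ Finset.Ioo (-((t : ℤ) + 1)) ((t : ℤ) + 1),
      ((t : ℝ) - |(s : ℝ)|) * ρ s.natAbs := by
    refine Finset.sum_subset (Finset.Ioo_subset_Ioo (by omega) (by omega)) fun s hs hs' => ?_
    simp only [Finset.mem_Ioo] at hs hs'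
    obtain rfl | rfl : s = t ∨ s = -(t : ℤ) := by omega
    all_goals simp
  rw [h1, ← sum_Ioo_neg_natAbs, ← Finset.sum_add_distrib, cumAutocorr]
  push_cast
  exact Finset.sum_congr rfl fun s _ => by ring

theorem cumAutocorr_eq_sum_sum (ρ : ℕ → ℝ) (t : ℕ) :
    cumAutocorr ρ t =
      ∑ a ∈ Finset.Icc 1 t, ∑ b ∈ Finset.Icc 1 t, ρ (max a b - min a b) := by
  induction t with
  | zero => simp [cumAutocorr]
  | succ t ih =>
    have h1 : ∑ a ∈ Finset.Icc 1 t, ρ (max a (t + 1) - min a (t + 1)) =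
        ∑ u ∈ Finset.Icc 1 t, ρ u := by
      refine Finset.sum_bij' (fun a _ => t + 1 - a) (fun a _ => t + 1 - a) ?_ ?_ ?_ ?_ ?_ <;>
        simp only [Finset.mem_Icc] <;> intro a ha
      · omega
      · omega
      · omega
      · omega
      · rw [max_eq_right (by omega), min_eq_left (by omega)]
    have h2 : ∑ b ∈ Finset.Icc 1 t, ρ (max (t + 1) b - min (t + 1) b) =
        ∑ u ∈ Finset.Icc 1 t, ρ u := by
      simp_rw [max_comm (t + 1), min_comm (t + 1)]
      exact h1
    rw [cumAutocorr_add_one, ih, Finset.sum_Icc_succ_top (by omega),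
      Finset.sum_Icc_succ_top (by omega), h2,
      Finset.sum_congr rfl fun a _ => Finset.sum_Icc_succ_top (by omega : 1 ≤ t + 1) _,
      Finset.sum_add_distrib, h1]
    simp
    ring

section Errors

variable {Ω : Type*} [MeasurableSpace Ω] {P : Measure Ω} {T : ℕ}
  {ε : ℕ → ℕ → Ω → ℝ} {ρ : ℕ → ℝ}

theorem PanelErrors.covariance_eq (hε : PanelErrors P T ε ρ) (i : ℕ) {a b : ℕ}
    (ha : a ∈ Finset.Icc 1 T) (hb : b ∈ Finset.Icc 1 T) :
    covariance (ε i a) (ε i b) P = ρ (max a b - min a b) := by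
  simp only [Finset.mem_Icc] at ha hb
  rcases le_total a b with h | h
  · have := hε.autocov i (b - a) (by omega) a (Finset.mem_Icc.2 (by omega))
    rw [Nat.add_sub_cancel' h] at this
    rw [this, max_eq_right h, min_eq_left h]
  · have := hε.autocov i (a - b) (by omega) b (Finset.mem_Icc.2 (by omega))
    rw [Nat.add_sub_cancel' h] at this
    rw [covariance_comm, this, max_eq_left h, min_eq_right h]

theorem PanelErrors.memLp_partialSum (hε : PanelErrors P T ε ρ) (i : ℕ) {t : ℕ} (ht : t ≤ T) :
    MemLp (fun ω => partialSum (fun r => ε i r ω) t) 2 P := by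
  refine memLp_finsetSum _ fun r hr => hε.memLp i r ?_
  simp only [Finset.mem_Icc] at hr ⊢
  omega

variable [IsProbabilityMeasure P]

theorem PanelErrors.integral_partialSum (hε : PanelErrors P T ε ρ) (i : ℕ) {t : ℕ} (ht : t ≤ T) :
    ∫ ω, partialSum (fun r => ε i r ω) t ∂P = 0 := by
  have h (r : ℕ) (hr : r ∈ Finset.Icc 1 t) : r ∈ Finset.Icc 1 T := by
    simp only [Finset.mem_Icc] at hr ⊢
    omega
  unfold partialSum
  rw [integral_finsetSum _ fun r hr => (hε.memLp i r (h r hr)).integrable (by norm_num)]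
  exact Finset.sum_eq_zero fun r hr => hε.mean i r (h r hr)

theorem PanelErrors.covariance_partialSum (hε : PanelErrors P T ε ρ) (i : ℕ) {t v : ℕ}
    (ht : t ≤ T) (hv : v ≤ T) :
    covariance (fun ω => partialSum (fun r => ε i r ω) t)
      (fun ω => partialSum (fun r => ε i r ω) v) P =
        ∑ a ∈ Finset.Icc 1 t, ∑ b ∈ Finset.Icc 1 v, ρ (max a b - min a b) := by
  have h {t : ℕ} (ht : t ≤ T) (r : ℕ) (hr : r ∈ Finset.Icc 1 t) : r ∈ Finset.Icc 1 T := by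
    simp only [Finset.mem_Icc] at hr ⊢
    omega
  unfold partialSum
  rw [covariance_fun_sum_fun_sum' (fun r hr => hε.memLp i r (h ht r hr))
    fun r hr => hε.memLp i r (h hv r hr)]
  exact Finset.sum_congr rfl fun a ha => Finset.sum_congr rfl fun b hb =>
    hε.covariance_eq i (h ht a ha) (h hv b hb)

theorem cumAutocorr_add_shiftedCumCorr (ρ : ℕ → ℝ) {t v : ℕ} (h : t ≤ v) :
    cumAutocorr ρ t + shiftedCumCorr ρ t v =
      ∑ a ∈ Finset.Icc 1 t, ∑ b ∈ Finset.Icc 1 v, ρ (max a b - min a b) := by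
  rw [cumAutocorr_eq_sum_sum, shiftedCumCorr, ← Finset.sum_add_distrib]
  refine Finset.sum_congr rfl fun a ha => ?_
  have h1 : ∑ u ∈ Finset.Icc (t + 1) v, ρ (u - a) =
      ∑ u ∈ Finset.Icc (t + 1) v, ρ (max a u - min a u) := by
    refine Finset.sum_congr rfl fun u hu => ?_
    simp only [Finset.mem_Icc] at ha hu
    rw [max_eq_right (by omega), min_eq_left (by omega)]
  rw [h1, sum_Icc_eq_partialSum_sub (fun u => ρ (max a u - min a u)) h]
  simp only [partialSum]
  ring

/-- `Λ` is the covariance matrix of the partial sums of the errors of a panel. -/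
theorem PanelErrors.covariance_partialSum_eq_limitCov (hε : PanelErrors P T ε ρ) (i : ℕ)
    (t v : Finset.Icc 1 T) :
    covariance (fun ω => partialSum (fun r => ε i r ω) t)
      (fun ω => partialSum (fun r => ε i r ω) v) P = limitCov T ρ t v := by
  have ht := (Finset.mem_Icc.1 t.2).2
  have hv := (Finset.mem_Icc.1 v.2).2
  simp only [limitCov, Matrix.of_apply]
  split_ifs with h
  · rw [← h, hε.covariance_partialSum i ht ht, cumAutocorr_eq_sum_sum]
  · rw [cumAutocorr_add_shiftedCumCorr ρ (min_le_max)]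
    rcases le_total (t : ℕ) v with h | h
    · rw [min_eq_left h, max_eq_right h, hε.covariance_partialSum i ht hv]
    · rw [min_eq_right h, max_eq_left h, covariance_comm, hε.covariance_partialSum i hv ht]

theorem PanelErrors.posSemidef_limitCov (hε : PanelErrors P T ε ρ) :
    (limitCov T ρ).PosSemidef :=
  posSemidef_of_covariance
    (fun t : Finset.Icc 1 T => hε.memLp_partialSum 0 (Finset.mem_Icc.1 t.2).2)
    (hε.covariance_partialSum_eq_limitCov 0)

/-! ### The normalised cumulative sums and their limit -/

/-- The vector of the normalised cumulative sums `N^{-1/2} ∑_{i < N} (e i 1 + ⋯ + e i t)`,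
`t = 1, …, T`. -/
noncomputable def scaledSums (T N : ℕ) (e : ℕ → ℕ → ℝ) : EuclideanSpace ℝ (Finset.Icc 1 T) :=
  (√N)⁻¹ • ∑ i ∈ Finset.range N, WithLp.toLp 2 fun t : Finset.Icc 1 T => partialSum (e i) t

theorem timeExt_scaledSums (N : ℕ) (e : ℕ → ℕ → ℝ) {t : ℕ} (ht : t ∈ Finset.Icc 1 T) :
    timeExt (scaledSums T N e) t =
      (√N)⁻¹ * ∑ i ∈ Finset.range N, partialSum (e i) t := by
  simp [timeExt_of_mem _ ht, scaledSums]

/-- The normalisation cancels in the ratios. -/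
theorem limitRatio_timeExt_scaledSums (N : ℕ) (e : ℕ → ℕ → ℝ) :
    limitRatio T (timeExt (scaledSums T N e)) =
      limitRatio T fun s => ∑ i ∈ Finset.range N, partialSum (e i) s := by
  rw [limitRatio_congr fun t ht => timeExt_scaledSums N e ht]
  rcases Nat.eq_zero_or_pos N with rfl | hN
  · simp
  · exact limitRatio_const_mul (by positivity) T _

theorem limitDen_timeExt_scaledSums (N : ℕ) (e : ℕ → ℕ → ℝ) {t : ℕ}
    (ht : t ∈ Finset.Icc 2 (T - 2)) :
    limitDen T (timeExt (scaledSums T N e)) t =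
      (√N)⁻¹ * limitDen T (fun s => ∑ i ∈ Finset.range N, partialSum (e i) s) t := by
  rw [limitDen_congr (fun t ht => timeExt_scaledSums N e ht) ht]
  exact limitDen_const_mul (by positivity) T _ t

theorem measurable_partialSum_timeExt :
    Measurable fun (x : Finset.Icc 1 T → ℝ) (t : Finset.Icc 1 T) =>
      partialSum (timeExt x) t := by
  refine measurable_pi_lambda _ fun t => Finset.measurable_fun_sum _ fun r _ => ?_
  unfold timeExt
  split_ifs <;> fun_prop

theorem partialSum_timeExt (e : ℕ → ℝ) (t : Finset.Icc 1 T) :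
    partialSum (timeExt fun r : Finset.Icc 1 T => e r) t = partialSum e t := by
  have ht := Finset.mem_Icc.1 t.2
  refine Finset.sum_congr rfl fun r hr => ?_
  rw [timeExt_of_mem _ (Finset.mem_Icc.2 (by simp only [Finset.mem_Icc] at hr; omega))]

theorem PanelErrors.tendstoInDistribution_scaledSums (hε : PanelErrors P T ε ρ)
    {Ω' : Type*} [MeasurableSpace Ω'] {P' : Measure Ω'} [IsProbabilityMeasure P']
    {X : Ω' → EuclideanSpace ℝ (Finset.Icc 1 T)}
    (hX : HasLaw X (multivariateGaussian 0 (limitCov T ρ)) P') :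
    TendstoInDistribution (fun N ω => scaledSums T N fun i r => ε i r ω) atTop X
      (fun _ => P) P' := by
  have hV (i : ℕ) : (fun (ω : Ω) (t : Finset.Icc 1 T) => partialSum (fun r => ε i r ω) t) =
      fun ω (t : Finset.Icc 1 T) => partialSum (timeExt fun r : Finset.Icc 1 T => ε i r ω) t := by
    ext ω t
    exact (partialSum_timeExt (fun r => ε i r ω) t).symm
  refine tendstoInDistribution_inv_sqrt_smul_sum
    (V := fun i ω (t : Finset.Icc 1 T) => partialSum (fun r => ε i r ω) t) ?_ (fun i => ?_)
    (fun t => hε.memLp_partialSum 0 (Finset.mem_Icc.1 t.2).2)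
    (fun t => hε.integral_partialSum 0 (Finset.mem_Icc.1 t.2).2)
    (hε.covariance_partialSum_eq_limitCov 0) hX
  · rw [funext hV]
    exact hε.indep.comp (fun _ (x : Finset.Icc 1 T → ℝ) (t : Finset.Icc 1 T) =>
      partialSum (timeExt x) t) fun _ => measurable_partialSum_timeExt
  · rw [hV i, hV 0]
    exact (hε.identDistrib i 0).comp measurable_partialSum_timeExt

/-! ### Linear combinations of the limit vector -/

/-- A linear combination of the limit vector is centred normal, with the variance of the same
combination of the partial sums of the errors. -/
theorem PanelErrors.hasLaw_inner_limit (hε : PanelErrors P T ε ρ)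
    {Ω' : Type*} [MeasurableSpace Ω'] {P' : Measure Ω'}
    {X : Ω' → EuclideanSpace ℝ (Finset.Icc 1 T)}
    (hX : HasLaw X (multivariateGaussian 0 (limitCov T ρ)) P')
    (u : EuclideanSpace ℝ (Finset.Icc 1 T)) :
    HasLaw (fun ω => inner ℝ u (X ω)) (gaussianReal 0
      (variance (fun ω => inner ℝ u (WithLp.toLp 2 fun t : Finset.Icc 1 T =>
        partialSum (fun r => ε 0 r ω) t)) P).toNNReal) P' := by
  rw [variance_inner_toLp
    (Z := fun (t : Finset.Icc 1 T) ω => partialSum (fun r => ε 0 r ω) t)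
    (fun t : Finset.Icc 1 T => hε.memLp_partialSum 0 (Finset.mem_Icc.1 t.2).2)
    (hε.covariance_partialSum_eq_limitCov 0)]
  exact hasLaw_inner_of_multivariateGaussian hε.posSemidef_limitCov hX u

theorem PanelErrors.variance_sub_succ (hε : PanelErrors P T ε ρ) (i : ℕ) {s : ℕ} (hs : 1 ≤ s)
    (hsT : s + 1 ≤ T) : variance (fun ω => ε i s ω - ε i (s + 1) ω) P = 2 - 2 * ρ 1 := by
  have h1 : s ∈ Finset.Icc 1 T := Finset.mem_Icc.2 (by omega)
  have h2 : s + 1 ∈ Finset.Icc 1 T := Finset.mem_Icc.2 (by omega)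
  have h3 := hε.autocov i 1 (by omega) s (Finset.mem_Icc.2 (by omega))
  rw [variance_fun_sub (hε.memLp i s h1) (hε.memLp i _ h2), hε.var i s h1, hε.var i _ h2, h3]
  ring

theorem PanelErrors.ae_limitDen_ne_zero (hε : PanelErrors P T ε ρ) (hρ : ρ 1 ≠ 1)
    {Ω' : Type*} [MeasurableSpace Ω'] {P' : Measure Ω'}
    {X : Ω' → EuclideanSpace ℝ (Finset.Icc 1 T)}
    (hX : HasLaw X (multivariateGaussian 0 (limitCov T ρ)) P') :
    ∀ᵐ ω ∂P', ∀ t ∈ Finset.Icc 2 (T - 2), limitDen T (timeExt (X ω)) t ≠ 0 := by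
  refine (ae_ball_iff (Finset.countable_toSet _)).2 fun t ht => ?_
  rw [Finset.mem_coe] at ht
  have h0 : t ∈ Finset.Icc 1 T := by simp only [Finset.mem_Icc] at ht ⊢; omega
  have h1 : t + 1 ∈ Finset.Icc 1 T := by simp only [Finset.mem_Icc] at ht ⊢; omega
  have h2 : t + 2 ∈ Finset.Icc 1 T := by simp only [Finset.mem_Icc] at ht ⊢; omega
  -- `u` is the functional `w ↦ 2 w (t + 1) - w t - w (t + 2)`, which maps the partial sums
  -- to `ε (t + 1) - ε (t + 2)`.
  let u : EuclideanSpace ℝ (Finset.Icc 1 T) := (2 : ℝ) • EuclideanSpace.single ⟨t + 1, h1⟩ 1 -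
    EuclideanSpace.single ⟨t, h0⟩ 1 - EuclideanSpace.single ⟨t + 2, h2⟩ 1
  have hu (w : EuclideanSpace ℝ (Finset.Icc 1 T)) :
      inner ℝ u w = 2 * w ⟨t + 1, h1⟩ - w ⟨t, h0⟩ - w ⟨t + 2, h2⟩ := by
    simp [u, inner_sub_left, inner_smul_left, EuclideanSpace.inner_single_left]
  have hlaw := hε.hasLaw_inner_limit hX u
  have hS (ω : Ω) : inner ℝ u (WithLp.toLp 2 fun t : Finset.Icc 1 T =>
      partialSum (fun r => ε 0 r ω) t) = ε 0 (t + 1) ω - ε 0 (t + 1 + 1) ω := by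
    simp only [hu, show t + 2 = t + 1 + 1 from rfl, partialSum_add_one]
    ring
  simp only [hS] at hlaw
  rw [hε.variance_sub_succ 0 (by omega) (Finset.mem_Icc.1 h2).2] at hlaw
  have hpos : 0 < 2 - 2 * ρ 1 := by
    have := variance_nonneg (fun ω => ε 0 (t + 1) ω - ε 0 (t + 1 + 1) ω) P
    rw [hε.variance_sub_succ 0 (by omega) (Finset.mem_Icc.1 h2).2] at this
    refine this.lt_of_ne fun h => hρ ?_
    linarith
  have : NullSingletonClass (gaussianReal 0 (2 - 2 * ρ 1).toNNReal) :=
    nullSingletonClass_gaussianReal (by simpa using hpos)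
  have hne : ∀ᵐ ω ∂P', inner ℝ u (X ω) ≠ 0 :=
    (hlaw.ae_iff (p := fun x => x ≠ 0) (measurableSet_singleton (0 : ℝ)).compl.mem).2
      (by simp [ae_iff, measure_singleton])
  filter_upwards [hne] with ω hω h
  have := two_mul_eq_of_limitDen_eq_zero ht h
  rw [timeExt_of_mem _ h0, timeExt_of_mem _ h1, timeExt_of_mem _ h2] at this
  exact hω (by rw [hu]; linarith)

/-! ### The degenerate case of perfectly correlated errors -/

theorem PanelErrors.ae_partialSum_eq (hε : PanelErrors P T ε ρ) (hρ : ρ 1 = 1) :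
    ∀ᵐ ω ∂P, ∀ i, ∀ s ∈ Finset.Icc 1 T, partialSum (fun r => ε i r ω) s = s * ε i 1 ω := by
  have h : ∀ᵐ ω ∂P, ∀ i s : ℕ, 1 ≤ s → s + 1 ≤ T → ε i s ω - ε i (s + 1) ω = 0 := by
    simp only [ae_all_iff]
    intro i s hs hsT
    have h1 : s ∈ Finset.Icc 1 T := Finset.mem_Icc.2 (by omega)
    have h2 : s + 1 ∈ Finset.Icc 1 T := Finset.mem_Icc.2 (by omega)
    have hv := hε.variance_sub_succ i hs hsT
    rw [hρ, mul_one, sub_self] at hv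
    filter_upwards [ae_eq_integral_of_variance_eq_zero
      ((hε.memLp i s h1).sub (hε.memLp i _ h2)) hv] with ω hω
    simp only [Pi.sub_apply] at hω
    rw [hω, integral_sub ((hε.memLp i s h1).integrable (by norm_num))
      ((hε.memLp i _ h2).integrable (by norm_num)), hε.mean i s h1, hε.mean i _ h2, sub_zero]
  filter_upwards [h] with ω hω i s hs
  have hconst (r : ℕ) (hr : 1 ≤ r) : r ≤ T → ε i r ω = ε i 1 ω := by
    induction r, hr using Nat.le_induction with
    | base => exact fun _ => rfl
    | succ r hr ih => exact fun hrT => by linarith [ih (by omega), hω i r hr hrT]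
  unfold partialSum
  rw [Finset.sum_congr rfl fun r hr => hconst r (Finset.mem_Icc.1 hr).1
    ((Finset.mem_Icc.1 hr).2.trans (Finset.mem_Icc.1 hs).2)]
  simp

theorem PanelErrors.ae_limitRatio_scaledSums_eq_zero (hε : PanelErrors P T ε ρ)
    (hρ : ρ 1 = 1) (N : ℕ) :
    ∀ᵐ ω ∂P, limitRatio T (timeExt (scaledSums T N fun i r => ε i r ω)) = 0 := by
  filter_upwards [hε.ae_partialSum_eq hρ] with ω hω
  rw [limitRatio_timeExt_scaledSums]
  refine limitRatio_eq_zero_of_linear (a := ∑ i ∈ Finset.range N, ε i 1 ω) fun s hs => ?_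
  rw [Finset.mul_sum]
  exact Finset.sum_congr rfl fun i _ => hω i s hs

theorem PanelErrors.ae_limitRatio_limit_eq_zero (hε : PanelErrors P T ε ρ) (hρ : ρ 1 = 1)
    {Ω' : Type*} [MeasurableSpace Ω'] {P' : Measure Ω'}
    {X : Ω' → EuclideanSpace ℝ (Finset.Icc 1 T)}
    (hX : HasLaw X (multivariateGaussian 0 (limitCov T ρ)) P') :
    ∀ᵐ ω ∂P', limitRatio T (timeExt (X ω)) = 0 := by
  have h : ∀ᵐ ω ∂P', ∀ s ∈ Finset.Icc 1 T, timeExt (X ω) s = s * timeExt (X ω) 1 := by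
    refine (ae_ball_iff (Finset.countable_toSet _)).2 fun s hs => ?_
    rw [Finset.mem_coe] at hs
    have h1 : 1 ∈ Finset.Icc 1 T := by simp only [Finset.mem_Icc] at hs ⊢; omega
    let u : EuclideanSpace ℝ (Finset.Icc 1 T) := EuclideanSpace.single ⟨s, hs⟩ 1 -
      (s : ℝ) • EuclideanSpace.single ⟨1, h1⟩ 1
    have hu (w : EuclideanSpace ℝ (Finset.Icc 1 T)) :
        inner ℝ u w = w ⟨s, hs⟩ - s * w ⟨1, h1⟩ := by
      simp [u, inner_sub_left, inner_smul_left, EuclideanSpace.inner_single_left]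
    have hlaw := hε.hasLaw_inner_limit hX u
    have hvar : variance (fun ω => inner ℝ u (WithLp.toLp 2 fun t : Finset.Icc 1 T =>
        partialSum (fun r => ε 0 r ω) t)) P = 0 := by
      have h0 : (fun ω => inner ℝ u (WithLp.toLp 2 fun t : Finset.Icc 1 T =>
          partialSum (fun r => ε 0 r ω) t)) =ᵐ[P] fun _ => (0 : ℝ) := by
        filter_upwards [hε.ae_partialSum_eq hρ] with ω hω
        simp [hu, hω 0 s hs, hω 0 1 h1]
      rw [variance_congr h0, ← Pi.zero_def, variance_zero]
    rw [hvar, Real.toNNReal_zero, gaussianReal_zero_var] at hlaw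
    filter_upwards [hlaw.ae_eq_of_dirac] with ω hω
    rw [hu] at hω
    rw [timeExt_of_mem _ hs, timeExt_of_mem _ h1]
    linarith
  filter_upwards [h] with ω hω
  exact limitRatio_eq_zero_of_linear hω

end Errors

/-! ### The limit law of the ratio statistic -/

/-- Convergence in distribution of the ratio type statistic under the null hypothesis `τ = T`.
The matrix `Λ` is a covariance matrix, the limit holds for every `N(0, Λ)` vector
`(X 1, …, X T)`, and, unless `ρ 1 = 1`, the ratios in the limit are almost surely well defined and
those in the statistic are so with probability tending to one. -/
theorem theorem1
    {Ω : Type*} [MeasurableSpace Ω] (P : Measure Ω) [IsProbabilityMeasure P]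
    {Ω' : Type*} [MeasurableSpace Ω'] (P' : Measure Ω') [IsProbabilityMeasure P']
    (T : ℕ) (hT : 4 ≤ T)
    (μ δ : ℕ → ℝ) (τ : ℕ) (σ : ℝ) (hσ : 0 < σ)
    (ε : ℕ → ℕ → Ω → ℝ) (ρ : ℕ → ℝ) (hε : PanelErrors P T ε ρ)
    (Y : ℕ → ℕ → Ω → ℝ) (hY : Y = panelObs μ δ τ σ ε)
    (hH₀ : τ = T)
    (X : ℕ → Ω' → ℝ)
    (hX : HasLaw (fun ω => WithLp.toLp 2 (fun t : Finset.Icc 1 T => X t ω))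
      (multivariateGaussian 0 (limitCov T ρ)) P') :
    (limitCov T ρ).PosSemidef ∧
    TendstoInDistribution (fun (N : ℕ) (ω : Ω) => ratioStat T N (fun i t => Y i t ω)) atTop
      (fun ω => limitRatio T (fun t => X t ω)) (fun _ => P) P' ∧
    (ρ 1 ≠ 1 →
      (∀ᵐ ω ∂P', ∀ t ∈ Finset.Icc 2 (T - 2), limitDen T (fun u => X u ω) t ≠ 0) ∧
      Tendsto (fun N : ℕ =>
          P {ω | ∃ t ∈ Finset.Icc 2 (T - 2), statDen T N (fun i u => Y i u ω) t = 0})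
        atTop (𝓝 0)) := by
  have hYε (ω : Ω) (i : ℕ) (r : ℕ) (hr : r ∈ Finset.Icc 1 T) :
      Y i r ω = μ i + σ * ε i r ω := by
    simp [hY, panelObs, hH₀, (Finset.mem_Icc.1 hr).2.not_gt]
  have hXext (ω : Ω') (t : ℕ) (ht : t ∈ Finset.Icc 1 T) :
      timeExt (WithLp.toLp 2 (fun t : Finset.Icc 1 T => X t ω)) t = X t ω := timeExt_of_mem _ ht
  have hstat (N : ℕ) (ω : Ω) : limitRatio T (timeExt (scaledSums T N fun i r => ε i r ω)) =
      ratioStat T N (fun i t => Y i t ω) := by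
    rw [limitRatio_timeExt_scaledSums, ratioStat_eq hσ (hYε ω)]
  have hclt := hε.tendstoInDistribution_scaledSums hX
  have hden (hρ : ρ 1 ≠ 1) := hε.ae_limitDen_ne_zero hρ hX
  refine ⟨hε.posSemidef_limitCov, ?_, fun hρ => ⟨?_, ?_⟩⟩
  · have key : TendstoInDistribution
        (fun N ω => limitRatio T (timeExt (scaledSums T N fun i r => ε i r ω))) atTop
        (fun ω => limitRatio T (timeExt (WithLp.toLp 2 (fun t : Finset.Icc 1 T => X t ω))))
        (fun _ => P) P' := by
      by_cases hρ : ρ 1 = 1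
      · have h0 : TendstoInDistribution (fun (_ : ℕ) (_ : Ω) => (0 : ℝ)) atTop
            (fun _ : Ω' => (0 : ℝ)) (fun _ => P) P' :=
          tendstoInDistribution_of_identDistrib 0
            (fun _ => IdentDistrib.refl aemeasurable_const)
            ⟨aemeasurable_const, aemeasurable_const, by simp⟩
        refine h0.congr (fun N => ?_) ?_
        · filter_upwards [hε.ae_limitRatio_scaledSums_eq_zero hρ N] with ω hω using hω.symm
        · filter_upwards [hε.ae_limitRatio_limit_eq_zero hρ hX] with ω hω using hω.symm
      · refine tendstoInDistribution_comp_of_ae_continuousAt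
          (g := fun w : EuclideanSpace ℝ (Finset.Icc 1 T) => limitRatio T (timeExt w))
          measurable_limitRatio_timeExt ?_ hclt
        filter_upwards [hden hρ] with ω hω using continuousAt_limitRatio_timeExt hω
    exact key.congr (fun N => Eventually.of_forall fun ω => hstat N ω)
      (Eventually.of_forall fun ω => limitRatio_congr (hXext ω))
  · filter_upwards [hden hρ] with ω hω t ht
    rw [← limitDen_congr (hXext ω) ht]
    exact hω t ht
  · let B : Set (EuclideanSpace ℝ (Finset.Icc 1 T)) :=
      ⋃ t ∈ Finset.Icc 2 (T - 2), {w | limitDen T (timeExt w) t = 0}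
    have hB : IsClosed B := isClosed_biUnion_finset fun t _ =>
      isClosed_eq (continuous_limitDen_timeExt t) continuous_const
    have hlim := ProbabilityMeasure.limsup_measure_closed_le_of_tendsto hclt.tendsto hB
    simp only [ProbabilityMeasure.coe_mk] at hlim
    rw [Measure.map_apply_of_aemeasurable hX.aemeasurable hB.measurableSet] at hlim
    have hnull : P' ((fun ω => WithLp.toLp 2 (fun t : Finset.Icc 1 T => X t ω)) ⁻¹' B) = 0 := by
      refine measure_mono_null (fun ω hω => ?_) (ae_iff.1 (hden hρ))
      simpa [B, and_assoc] using hω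
    rw [hnull] at hlim
    have hto : Tendsto (fun N : ℕ => (P.map fun ω => scaledSums T N fun i r => ε i r ω) B) atTop
        (𝓝 0) := tendsto_of_le_liminf_of_limsup_le zero_le hlim
    refine hto.congr' ?_
    filter_upwards [eventually_gt_atTop 0] with N hN
    rw [Measure.map_apply_of_aemeasurable (hclt.forall_aemeasurable N) hB.measurableSet]
    congr 1
    ext ω
    simp only [B, Set.mem_preimage, Set.mem_iUnion, Set.mem_ofPred_eq, exists_prop]
    refine exists_congr fun t => and_congr_right fun ht => ?_
    have : (√(N : ℝ))⁻¹ ≠ 0 := by positivity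
    rw [limitDen_timeExt_scaledSums N _ ht, statDen_eq hσ.le (hYε ω) ht,
      mul_eq_zero_iff_left this, mul_eq_zero_iff_left hσ.ne']
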